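/- For $\tau\in\mathbb{C}$ with $\operatorname{Im}\tau>0$, $z\in\mathbb{C}$ and a real characteristic $\left[{}^{\varepsilon'}_{\varepsilon}\right]$, i.e. $(\varepsilon',\varepsilon)\in\mathbb{R}^2$, let $$\theta\left[{}^{\varepsilon'}_{\varepsilon}\right](z,\tau)=\sum_{n\in\mathbb{Z}}\exp\left(\pi i (n+\varepsilon')^2\tau+2\pi i(n+\varepsilon')(z+\varepsilon)\right),\qquad \theta'\left[{}^{\varepsilon'}_{\varepsilon}\right](z,\tau)=\frac{\partial}{\partial z}\theta\left[{}^{\varepsilon'}_{\varepsilon}\right](z,\tau).$$ **Theorem (fundamental theta derivative identity).** For every real characteristic $\left[{}^{\varepsilon'}_{\varepsilon}\right]\in\mathbb{R}^2$ and every $\tau$ with $\operatorname{Im}\tau>0$, $$\theta\left[{}^{\varepsilon'}_{\varepsilon}\right](0,\tau)^2\left(3\,\theta\left[{}^{3\varepsilon'}_{3\varepsilon}\right](0,\tau)\,\theta'\left[{}^{\varepsilon'}_{\varepsilon}\right](0,\tau)-\theta'\left[{}^{3\varepsilon'}_{3\varepsilon}\right](0,\tau)\,\theta\left[{}^{\varepsilon'}_{\varepsilon}\right](0,\tau)\right)=e^{6\pi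 i\varepsilon'}\,\theta'\left[{}^{1/2}_{1/2}\right](0,\tau)\;\theta\left[{}^{\frac12-2\varepsilon'}_{\frac12-2\varepsilon}\right](0,\tau)^3 .$$ -/

import Mathlib

/-- The `n`-th term of the theta series with real characteristic `[ε'; ε]`:
`exp (π i (n + ε')² τ + 2 π i (n + ε') (z + ε))`. -/
noncomputable def thetaCharTerm (ε' ε : ℝ) (z τ : ℂ) (n : ℤ) : ℂ :=
  Complex.exp (Real.pi * Complex.I * (n + ε') ^ 2 * τ
    + 2 * Real.pi * Complex.I * (n + ε') * (z + ε))

/-- The theta function with real characteristic `[ε'; ε]`. -/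
noncomputable def thetaChar (ε' ε : ℝ) (z τ : ℂ) : ℂ :=
  ∑' n : ℤ, thetaCharTerm ε' ε z τ n

/-- The derivative in the argument `z` of the theta function with characteristic `[ε'; ε]`. -/
noncomputable def thetaCharDeriv (ε' ε : ℝ) (z τ : ℂ) : ℂ :=
  deriv (fun w : ℂ => thetaChar ε' ε w τ) z

theorem thetaCharTerm_eq (ε' ε : ℝ) (z τ : ℂ) (n : ℤ) :
    thetaCharTerm ε' ε z τ n =
      Complex.exp (Real.pi * Complex.I * ε' ^ 2 * τ + 2 * Real.pi * Complex.I * ε' * (z + ε))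
        * jacobiTheta₂_term n (z + τ * ε' + ε) τ := by
  rw [thetaCharTerm, jacobiTheta₂_term, ← Complex.exp_add]
  congr 1
  ring

/-- On the upper half-plane the defining series converges (absolutely), so its sum is genuine. -/
theorem summable_thetaCharTerm (ε' ε : ℝ) (z : ℂ) {τ : ℂ} (hτ : 0 < τ.im) :
    Summable (thetaCharTerm ε' ε z τ) := by
  simp_rw [funext (thetaCharTerm_eq ε' ε z τ)]
  exact ((summable_jacobiTheta₂_term_iff _ τ).2 hτ).mul_left _

theorem thetaChar_eq (ε' ε : ℝ) (z τ : ℂ) :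
    thetaChar ε' ε z τ =
      Complex.exp (Real.pi * Complex.I * ε' ^ 2 * τ + 2 * Real.pi * Complex.I * ε' * (z + ε))
        * jacobiTheta₂ (z + τ * ε' + ε) τ := by
  simp_rw [thetaChar, thetaCharTerm_eq, tsum_mul_left, jacobiTheta₂]

/-- On the upper half-plane the theta function is entire in `z`, so `thetaCharDeriv` is a genuine
derivative. -/
theorem differentiable_thetaChar (ε' ε : ℝ) {τ : ℂ} (hτ : 0 < τ.im) :
    Differentiable ℂ (fun z : ℂ => thetaChar ε' ε z τ) := by
  intro z
  simp_rw [thetaChar_eq]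
  refine DifferentiableAt.mul (by fun_prop) ?_
  exact (differentiableAt_jacobiTheta₂_fst (z + τ * ε' + ε) hτ).comp z
    (f := fun z : ℂ => z + τ * ε' + ε) (by fun_prop)

/-!
Write `ϑ = θ[0; 0]` and `S = θ[1/2; 1/2]` at the modulus `τ`, and let `A`, `B` be the functions
`a ↦ θ[0; 0](2a, 2τ)` and `a ↦ θ[1/2; 0](2a, 2τ)`. Splitting the sum over `ℤ × ℤ` according to the
parity of the sum of the two indices gives the addition formulas
`ϑ(a + b) ϑ(a - b) = A(a) A(b) + B(a) B(b)` and `S(a + b) S(a - b) = A(a) B(b) - B(a) A(b)`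
(`thetaChar_zero_mul_thetaChar_zero`, `thetaChar_half_mul_thetaChar_half`).

With the two-dimensional vectors `(A, B)` taken at the points `2u`, `u - h`, `u + h`, `0`, the
Lagrange identity `⟨P, Q⟩⟨R, O⟩ - ⟨P, R⟩⟨Q, O⟩ = det(P, O) det(Q, R)` becomes the three-term relation
`ϑ(u + h)³ ϑ(3u - h) - ϑ(u - h)³ ϑ(3u + h) = S(2u)³ S(-2h)` (`thetaChar_three_term`).
Its derivative at `h = 0` is the asserted identity for `ϑ` at `u = ε' τ + ε`. A real characteristic
only contributes exponential factors: `θ[ε'; ε](z)` is such a factor times `ϑ(z + u)`, and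
`θ[1/2 - 2ε'; 1/2 - 2ε](0)` is one times `S(2u)`; the derivatives of the factors cancel because the
logarithmic derivative for `[3ε'; 3ε]` is three times the one for `[ε'; ε]`.
-/

/-- The lattice `ℤ × ℤ` is the union of the two cosets of the sublattice of pairs of the same
parity. That sublattice is parametrized by `(p + q, p - q)`; the representative of the other coset
is `(c, c - 1)` for an arbitrary `c`. -/
noncomputable def intProdSumEquiv (c : ℤ) : (ℤ × ℤ) ⊕ (ℤ × ℤ) ≃ ℤ × ℤ :=
  Equiv.ofBijective
    (Sum.elim (fun x => (x.1 + x.2, x.1 - x.2)) (fun x => (x.1 + x.2 + c, x.1 - x.2 + (c - 1))))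
    (by
      constructor
      · rintro (⟨p, q⟩ | ⟨p, q⟩) (⟨r, s⟩ | ⟨r, s⟩) h <;>
          simp only [Sum.elim_inl, Sum.elim_inr, Prod.mk.injEq] at h
        · simp only [Sum.inl.injEq, Prod.mk.injEq]; omega
        · omega
        · omega
        · simp only [Sum.inr.injEq, Prod.mk.injEq]; omega
      · rintro ⟨m, n⟩
        rcases Int.even_or_odd' (m + n) with ⟨k, hk | hk⟩
        · exact ⟨Sum.inl (k, m - k), by simp only [Sum.elim_inl, Prod.mk.injEq]; omega⟩
        · exact ⟨Sum.inr (k + 1 - c, m - k - 1), by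
            simp only [Sum.elim_inr, Prod.mk.injEq]; omega⟩)

/-- A product of two series over `ℤ` whose terms separate on both parity cosets of `ℤ × ℤ` is a sum
of two products of series. -/
theorem tsum_mul_tsum_eq_of_separate (c : ℤ) {f g f₁ g₁ f₂ g₂ : ℤ → ℂ}
    (hf : Summable f) (hg : Summable g) (hf₁ : Summable f₁) (hg₁ : Summable g₁)
    (hf₂ : Summable f₂) (hg₂ : Summable g₂)
    (h₁ : ∀ p q, f (p + q) * g (p - q) = f₁ p * g₁ q)
    (h₂ : ∀ p q, f (p + q + c) * g (p - q + (c - 1)) = f₂ p * g₂ q) :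
    (∑' n, f n) * ∑' n, g n = (∑' n, f₁ n) * (∑' n, g₁ n) + (∑' n, f₂ n) * ∑' n, g₂ n := by
  rw [tsum_mul_tsum_of_summable_norm hf.norm hg.norm,
    tsum_mul_tsum_of_summable_norm hf₁.norm hg₁.norm,
    tsum_mul_tsum_of_summable_norm hf₂.norm hg₂.norm,
    ← (intProdSumEquiv c).tsum_eq (fun z : ℤ × ℤ => f z.1 * g z.2)]
  have e₁ : ∀ x : ℤ × ℤ, f (intProdSumEquiv c (Sum.inl x)).1 * g (intProdSumEquiv c (Sum.inl x)).2
      = f₁ x.1 * g₁ x.2 := fun x => h₁ x.1 x.2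
  have e₂ : ∀ x : ℤ × ℤ, f (intProdSumEquiv c (Sum.inr x)).1 * g (intProdSumEquiv c (Sum.inr x)).2
      = f₂ x.1 * g₂ x.2 := fun x => h₂ x.1 x.2
  have s₁ := summable_mul_of_summable_norm hf₁.norm hg₁.norm
  have s₂ := summable_mul_of_summable_norm hf₂.norm hg₂.norm
  rw [Summable.tsum_sum]
  · simp_rw [e₁, e₂]
  · exact s₁.congr fun x => (e₁ x).symm
  · exact s₂.congr fun x => (e₂ x).symm

theorem thetaChar_zero_mul_thetaChar_zero (a b : ℂ) {τ : ℂ} (hτ : 0 < τ.im) :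
    thetaChar 0 0 (a + b) τ * thetaChar 0 0 (a - b) τ
      = thetaChar 0 0 (2 * a) (2 * τ) * thetaChar 0 0 (2 * b) (2 * τ)
        + thetaChar (1 / 2) 0 (2 * a) (2 * τ) * thetaChar (1 / 2) 0 (2 * b) (2 * τ) := by
  have hτ₂ : 0 < (2 * τ).im := by simpa using hτ
  refine tsum_mul_tsum_eq_of_separate 1 (summable_thetaCharTerm _ _ _ hτ)
    (summable_thetaCharTerm _ _ _ hτ) (summable_thetaCharTerm _ _ _ hτ₂)
    (summable_thetaCharTerm _ _ _ hτ₂) (summable_thetaCharTerm _ _ _ hτ₂)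
    (summable_thetaCharTerm _ _ _ hτ₂) (fun p q => ?_) (fun p q => ?_) <;>
  · simp only [thetaCharTerm, ← Complex.exp_add]
    congr 1
    push_cast
    ring

theorem exp_two_pi_I_mul_add_half (n : ℤ) :
    Complex.exp (2 * Real.pi * Complex.I * (n + 1 / 2)) = -1 := by
  rw [show 2 * (Real.pi : ℂ) * Complex.I * (n + 1 / 2)
      = n * (2 * Real.pi * Complex.I) + Real.pi * Complex.I by ring, Complex.exp_add,
    Complex.exp_int_mul_two_pi_mul_I, Complex.exp_pi_mul_I, one_mul]

theorem thetaChar_half_mul_thetaChar_half (a b : ℂ) {τ : ℂ} (hτ : 0 < τ.im) :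
    thetaChar (1 / 2) (1 / 2) (a + b) τ * thetaChar (1 / 2) (1 / 2) (a - b) τ
      = thetaChar 0 0 (2 * a) (2 * τ) * thetaChar (1 / 2) 0 (2 * b) (2 * τ)
        - thetaChar (1 / 2) 0 (2 * a) (2 * τ) * thetaChar 0 0 (2 * b) (2 * τ) := by
  have hτ₂ : 0 < (2 * τ).im := by simpa using hτ
  rw [sub_eq_neg_add (thetaChar 0 0 _ _ * _), ← neg_mul]
  simp only [thetaChar, ← tsum_neg]
  refine tsum_mul_tsum_eq_of_separate 0 (summable_thetaCharTerm _ _ _ hτ)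
    (summable_thetaCharTerm _ _ _ hτ) (summable_thetaCharTerm _ _ _ hτ₂).neg
    (summable_thetaCharTerm _ _ _ hτ₂) (summable_thetaCharTerm _ _ _ hτ₂)
    (summable_thetaCharTerm _ _ _ hτ₂) (fun p q => ?_) (fun p q => ?_)
  -- The characteristic `1/2` in `ε` contributes `exp (2πi P)` with `P` the half-sum of the two
  -- shifted indices: `-1` when `P` is a half-integer, `1` when `P` is an integer.
  · rw [neg_eq_neg_one_mul, ← exp_two_pi_I_mul_add_half p]
    simp only [thetaCharTerm, ← Complex.exp_add]
    congr 1
    push_cast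
    ring
  · rw [← one_mul (thetaCharTerm 0 0 _ _ p), ← Complex.exp_int_mul_two_pi_mul_I p]
    simp only [thetaCharTerm, ← Complex.exp_add]
    congr 1
    push_cast
    ring

/-- A case of Weierstrass's three-term relation, with the variables specialized so that its
derivative at `h = 0` involves only the arguments `u`, `2u` and `3u`. -/
theorem thetaChar_three_term (u h : ℂ) {τ : ℂ} (hτ : 0 < τ.im) :
    thetaChar 0 0 (u + h) τ ^ 3 * thetaChar 0 0 (3 * u - h) τ
        - thetaChar 0 0 (u - h) τ ^ 3 * thetaChar 0 0 (3 * u + h) τ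
      = thetaChar (1 / 2) (1 / 2) (2 * u) τ ^ 3 * thetaChar (1 / 2) (1 / 2) (-2 * h) τ := by
  have h₁ := thetaChar_zero_mul_thetaChar_zero (2 * u) (u - h) hτ
  have h₂ := thetaChar_zero_mul_thetaChar_zero (u + h) 0 hτ
  have h₃ := thetaChar_zero_mul_thetaChar_zero (2 * u) (u + h) hτ
  have h₄ := thetaChar_zero_mul_thetaChar_zero (u - h) 0 hτ
  have h₅ := thetaChar_half_mul_thetaChar_half (2 * u) 0 hτ
  have h₆ := thetaChar_half_mul_thetaChar_half (u - h) (u + h) hτ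
  rw [show 2 * u + (u - h) = 3 * u - h by ring, show 2 * u - (u - h) = u + h by ring] at h₁
  rw [show 2 * u + (u + h) = 3 * u + h by ring, show 2 * u - (u + h) = u - h by ring] at h₃
  rw [show u - h + (u + h) = 2 * u by ring, show u - h - (u + h) = -2 * h by ring] at h₆
  simp only [add_zero, sub_zero] at h₂ h₄ h₅
  calc _ = (thetaChar 0 0 (3 * u - h) τ * thetaChar 0 0 (u + h) τ)
          * (thetaChar 0 0 (u + h) τ * thetaChar 0 0 (u + h) τ)
        - (thetaChar 0 0 (3 * u + h) τ * thetaChar 0 0 (u - h) τ)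
          * (thetaChar 0 0 (u - h) τ * thetaChar 0 0 (u - h) τ) := by ring
    _ = (thetaChar (1 / 2) (1 / 2) (2 * u) τ * thetaChar (1 / 2) (1 / 2) (2 * u) τ)
          * (thetaChar (1 / 2) (1 / 2) (2 * u) τ * thetaChar (1 / 2) (1 / 2) (-2 * h) τ) := by
        rw [h₁, h₂, h₃, h₄, h₅, h₆]; ring
    _ = _ := by ring

theorem hasDerivAt_thetaChar (ε' ε : ℝ) (z : ℂ) {τ : ℂ} (hτ : 0 < τ.im) :
    HasDerivAt (fun w => thetaChar ε' ε w τ) (thetaCharDeriv ε' ε z τ) z :=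
  (differentiable_thetaChar ε' ε hτ z).hasDerivAt

/-- The theta derivative identity at the zero characteristic and an arbitrary complex argument. -/
theorem thetaCharDeriv_zero_identity (u : ℂ) {τ : ℂ} (hτ : 0 < τ.im) :
    thetaChar 0 0 u τ ^ 2 * (3 * thetaChar 0 0 (3 * u) τ * thetaCharDeriv 0 0 u τ
        - thetaCharDeriv 0 0 (3 * u) τ * thetaChar 0 0 u τ)
      = -(thetaCharDeriv (1 / 2) (1 / 2) 0 τ * thetaChar (1 / 2) (1 / 2) (2 * u) τ ^ 3) := by
  have hadd : ∀ v : ℂ,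
      HasDerivAt (fun h => thetaChar 0 0 (v + h) τ) (thetaCharDeriv 0 0 v τ) 0 := fun v => by
    simpa using HasDerivAt.comp_const_add v 0
      (by simpa using hasDerivAt_thetaChar 0 0 v hτ)
  have hsub : ∀ v : ℂ,
      HasDerivAt (fun h => thetaChar 0 0 (v - h) τ) (-thetaCharDeriv 0 0 v τ) 0 := fun v => by
    simpa using HasDerivAt.comp_const_sub v 0
      (by simpa using hasDerivAt_thetaChar 0 0 v hτ)
  have hL := (((hadd u).pow 3).mul (hsub (3 * u))).sub (((hsub u).pow 3).mul (hadd (3 * u)))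
  have hS : HasDerivAt (fun h => thetaChar (1 / 2) (1 / 2) (-2 * h) τ)
      (thetaCharDeriv (1 / 2) (1 / 2) 0 τ * -2) 0 := by
    have hlin : HasDerivAt (fun h : ℂ => -2 * h) (-2) 0 := by
      simpa using (hasDerivAt_id (0 : ℂ)).const_mul (-2)
    exact HasDerivAt.comp (0 : ℂ) (h₂ := fun w => thetaChar (1 / 2) (1 / 2) w τ)
      (by simpa using hasDerivAt_thetaChar (1 / 2) (1 / 2) 0 hτ) hlin
  have hR := hS.const_mul (thetaChar (1 / 2) (1 / 2) (2 * u) τ ^ 3)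
  have key := hL.unique (hR.congr_of_eventuallyEq
    (Filter.Eventually.of_forall fun h => thetaChar_three_term u h hτ))
  simp only [Pi.pow_apply, add_zero, sub_zero] at key
  push_cast at key
  linear_combination key / 2

/-- A real characteristic amounts to an exponential factor and a translation of the argument. -/
theorem thetaChar_eq_exp_mul_thetaChar_zero (ε' ε : ℝ) (z τ : ℂ) :
    thetaChar ε' ε z τ =
      Complex.exp (Real.pi * Complex.I * ε' ^ 2 * τ + 2 * Real.pi * Complex.I * ε' * (z + ε))
        * thetaChar 0 0 (z + (ε' * τ + ε)) τ := by
  rw [thetaChar_eq ε' ε, thetaChar_eq 0 0]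
  simp [add_assoc, mul_comm τ]

theorem thetaCharDeriv_zero_arg (ε' ε : ℝ) {τ : ℂ} (hτ : 0 < τ.im) :
    thetaCharDeriv ε' ε 0 τ =
      Complex.exp (Real.pi * Complex.I * ε' ^ 2 * τ + 2 * Real.pi * Complex.I * ε' * ε)
        * (2 * Real.pi * Complex.I * ε' * thetaChar 0 0 (ε' * τ + ε) τ
          + thetaCharDeriv 0 0 (ε' * τ + ε) τ) := by
  have hlin : HasDerivAt (fun z : ℂ => Real.pi * Complex.I * ε' ^ 2 * τ
      + 2 * Real.pi * Complex.I * ε' * (z + ε)) (2 * Real.pi * Complex.I * ε') 0 := by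
    simpa using (((hasDerivAt_id (0 : ℂ)).add_const (ε : ℂ)).const_mul
      (2 * Real.pi * Complex.I * ε')).const_add (Real.pi * Complex.I * ε' ^ 2 * τ)
  have hshift : HasDerivAt (fun z => thetaChar 0 0 (z + (ε' * τ + ε)) τ)
      (thetaCharDeriv 0 0 (ε' * τ + ε) τ) 0 :=
    HasDerivAt.comp_add_const 0 (ε' * τ + ε : ℂ)
      (by simpa using hasDerivAt_thetaChar 0 0 (ε' * τ + ε) hτ)
  rw [thetaCharDeriv, funext fun z => thetaChar_eq_exp_mul_thetaChar_zero ε' ε z τ]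
  refine (hlin.cexp.mul hshift).deriv.trans ?_
  simp only [zero_add]
  ring

/-- The reflection `n ↦ -1 - n` of the summation index turns the characteristic
`[1/2 - 2ε'; 1/2 - 2ε]` into a translate of the odd theta function. -/
theorem thetaChar_half_sub (ε' ε : ℝ) (τ : ℂ) :
    thetaChar (1 / 2 - 2 * ε') (1 / 2 - 2 * ε) 0 τ =
      -(Complex.exp (4 * Real.pi * Complex.I * ε' ^ 2 * τ + 8 * Real.pi * Complex.I * ε' * ε
          - 2 * Real.pi * Complex.I * ε')
        * thetaChar (1 / 2) (1 / 2) (2 * (ε' * τ + ε)) τ) := by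
  rw [thetaChar, thetaChar, ← tsum_mul_left, ← tsum_neg, ← (Equiv.subLeft (-1 : ℤ)).tsum_eq]
  refine tsum_congr fun n => ?_
  rw [← neg_one_mul (Complex.exp _ * _), ← exp_two_pi_I_mul_add_half (-1 - n)]
  simp only [thetaCharTerm, ← Complex.exp_add, Equiv.subLeft_apply]
  congr 1
  push_cast
  ring

theorem mainTheorem1 (ε' ε : ℝ) (τ : ℂ) (hτ : 0 < τ.im) :
    thetaChar ε' ε 0 τ ^ 2 *
        (3 * thetaChar (3 * ε') (3 * ε) 0 τ * thetaCharDeriv ε' ε 0 τ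
          - thetaCharDeriv (3 * ε') (3 * ε) 0 τ * thetaChar ε' ε 0 τ)
      = Complex.exp (6 * Real.pi * Complex.I * ε') * thetaCharDeriv (1 / 2) (1 / 2) 0 τ
          * thetaChar (1 / 2 - 2 * ε') (1 / 2 - 2 * ε) 0 τ ^ 3 := by
  have key := thetaCharDeriv_zero_identity (ε' * τ + ε) hτ
  have h₃ : ((3 * ε' : ℝ) : ℂ) * τ + (3 * ε : ℝ) = 3 * (ε' * τ + ε) := by push_cast; ring
  rw [thetaCharDeriv_zero_arg ε' ε hτ, thetaCharDeriv_zero_arg (3 * ε') (3 * ε) hτ,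
    thetaChar_eq_exp_mul_thetaChar_zero ε' ε, thetaChar_eq_exp_mul_thetaChar_zero (3 * ε') (3 * ε),
    thetaChar_half_sub, h₃]
  simp only [zero_add]
  set E₁ := Complex.exp (Real.pi * Complex.I * ε' ^ 2 * τ + 2 * Real.pi * Complex.I * ε' * ε)
    with hE₁
  set E₃ := Complex.exp (Real.pi * Complex.I * (3 * ε' : ℝ) ^ 2 * τ
    + 2 * Real.pi * Complex.I * (3 * ε' : ℝ) * (3 * ε : ℝ)) with hE₃
  set F := Complex.exp (4 * Real.pi * Complex.I * ε' ^ 2 * τ + 8 * Real.pi * Complex.I * ε' * ε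
    - 2 * Real.pi * Complex.I * ε') with hF
  have hexp : E₁ ^ 3 * E₃ = Complex.exp (6 * Real.pi * Complex.I * ε') * F ^ 3 := by
    rw [hE₁, hE₃, hF, ← Complex.exp_nat_mul, ← Complex.exp_nat_mul, ← Complex.exp_add,
      ← Complex.exp_add]
    congr 1
    push_cast
    ring
  push_cast
  linear_combination E₁ ^ 3 * E₃ * key
    - thetaCharDeriv (1 / 2) (1 / 2) 0 τ
      * thetaChar (1 / 2) (1 / 2) (2 * (ε' * τ + ε)) τ ^ 3 * hexp
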